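/- Let $G$ be an abelian group that has no element of order $2$ and no element of order $3$. Let $\Delta(G)$ be the augmentation ideal of the integral group ring $\mathbb{Z}G$, let $\mathcal{V}(\mathbb{Z}G)$ be the group of units of $\mathbb{Z}G$ of augmentation one, and for $n\ge 1$ put $\mathcal{V}_n(\mathbb{Z}G)=\mathcal{V}(\mathbb{Z}G)\cap(1+\Delta^n(G))$. Then the $\Delta$-adic residue $$\mathcal{V}_\omega(\mathbb{Z}G):=\bigcap_{n\ge 1}\mathcal{V}_n(\mathbb{Z}G)$$ is trivial, i.e. equal to $\{1\}$, if and only if $G$ is torsion-free or there is a prime $p$ such that the torsion subgroup $T$ of $G$ is a $p$-group in which no element other than the identity has infinite $p$-height. Here an element $g$ of a group $H$ has infinite $p$-height in $H$ if for all natural numbers $i$ and $j\geq 1$ there exist $x\in H$ and $y\in\gamma_j(H)$ with $x^{p^i}=gy$, where $\gamma_j(H)$ denotes the $j$-th term of the lower central series of $H$ (with $\gamma_1(H)=H$). -/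

import Mathlib

namespace DeltaAdic

noncomputable section

/-- The augmentation homomorphism `ℤG → ℤ`, sending every group element to `1`. -/
def augmentation (G : Type*) [Group G] : MonoidAlgebra ℤ G →ₐ[ℤ] ℤ :=
  MonoidAlgebra.lift ℤ ℤ G (1 : G →* ℤ)

theorem augmentation_single {G : Type*} [Group G] (g : G) (a : ℤ) :
    augmentation G (MonoidAlgebra.single g a) = a := by
  simp [augmentation, MonoidAlgebra.lift_single]

/-- The augmentation ideal `Δ(G)` of the integral group ring `ℤG`. -/
def augmentationIdeal (G : Type*) [Group G] : Ideal (MonoidAlgebra ℤ G) :=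
  RingHom.ker (augmentation G)

instance (G : Type*) [Group G] : (augmentationIdeal G).IsTwoSided :=
  inferInstanceAs (RingHom.ker (augmentation G)).IsTwoSided

/-- The group `𝒱(ℤG)` of normalized units: the units of `ℤG` of augmentation one. -/
def normalizedUnits (G : Type*) [Group G] : Subgroup (MonoidAlgebra ℤ G)ˣ where
  carrier := {u | augmentation G (u : MonoidAlgebra ℤ G) = 1}
  one_mem' := by simp
  mul_mem' := by
    intro u v hu hv
    simp only [Set.mem_ofPred_eq] at hu hv ⊢
    simp [hu, hv]
  inv_mem' := by
    intro u hu
    simp only [Set.mem_ofPred_eq] at hu ⊢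
    have h := congrArg (augmentation G) u.mul_inv
    rwa [map_mul, hu, one_mul, map_one] at h

/-- The `n`-th term `𝒱ₙ(ℤG) = 𝒱(ℤG) ∩ (1 + Δⁿ(G))` of the `Δ`-adic filtration. -/
def deltaFiltration (G : Type*) [Group G] (n : ℕ) : Subgroup (MonoidAlgebra ℤ G)ˣ where
  carrier := {u | u ∈ normalizedUnits G ∧
    (u : MonoidAlgebra ℤ G) - 1 ∈ augmentationIdeal G ^ n}
  one_mem' := ⟨one_mem _, by simp⟩
  mul_mem' := by
    rintro u v ⟨hu, hu'⟩ ⟨hv, hv'⟩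
    refine ⟨mul_mem hu hv, ?_⟩
    have e : ((u * v : (MonoidAlgebra ℤ G)ˣ) : MonoidAlgebra ℤ G) - 1
        = u * ((v : MonoidAlgebra ℤ G) - 1) + ((u : MonoidAlgebra ℤ G) - 1) := by
      rw [Units.val_mul, mul_sub, mul_one, sub_add_sub_cancel]
    rw [e]
    exact add_mem (Ideal.mul_mem_left _ _ hv') hu'
  inv_mem' := by
    rintro u ⟨hu, hu'⟩
    refine ⟨inv_mem hu, ?_⟩
    have e : ((u⁻¹ : (MonoidAlgebra ℤ G)ˣ) : MonoidAlgebra ℤ G) - 1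
        = -((u⁻¹ : (MonoidAlgebra ℤ G)ˣ) : MonoidAlgebra ℤ G)
            * ((u : MonoidAlgebra ℤ G) - 1) := by
      rw [neg_mul, mul_sub, mul_one, Units.inv_mul, neg_sub]
    rw [e]
    exact Ideal.mul_mem_left _ _ hu'

/-- The `Δ`-adic residue `𝒱_ω(ℤG) = ⋂_{n ≥ 1} 𝒱ₙ(ℤG)`. -/
def deltaResidue (G : Type*) [Group G] : Subgroup (MonoidAlgebra ℤ G)ˣ :=
  ⨅ n : ℕ, ⨅ _ : 1 ≤ n, deltaFiltration G n

/-- `g` has infinite `p`-height in `G`: for all `i` and all `j ≥ 1` there are `x ∈ G` and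
`y ∈ γⱼ(G)` with `x ^ (p ^ i) = g * y`.  Mathlib numbers the lower central series from `0`, so
that `γⱼ(G)` is `(⊤ : Subgroup G).lowerCentralSeries (j - 1)`. -/
def HasInfinitePHeight {G : Type*} [Group G] (p : ℕ) (g : G) : Prop :=
  ∀ i j : ℕ, 1 ≤ j → ∃ x : G, ∃ y ∈ (⊤ : Subgroup G).lowerCentralSeries (j - 1), x ^ (p ^ i) = g * y

end

end DeltaAdic

/-!
If `c` has order prime to `6`, then `φ c = 1 - c + c ^ 2` is a unit: modulo `φ c` one has both
`c ^ 6 = 1` and `c ^ n = 1`, hence `c = 1`, hence `1 = 0`. Moreover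
`φ (ab) - φ a φ b = (a - 1)(b - 1)(a + b) ≠ 0`, so a trivial residue excludes nontrivial torsion
elements `a`, `b` with `(a - 1)(b - 1) ∈ ⋂ Δⁿ`. The latter holds when `b ^ p = 1` and `a` is a
`p ^ i`-th power for every `i`.

Conversely, let `u` lie in the residue, let `A` be the quotient of `G` by its torsion subgroup, let
`χ` be a character of `p`-power order and `R` the ring generated by its values. Consider the image
of `u` in `R[A]` under `g ↦ χ(g) g`. Since `A` is torsion-free, units of `R[A]` are trivial.
The coefficient of this image is `1` by Krull's intersection theorem in `R`, and its group element
is `1` because it is so modulo a prime above `p`, where `χ` becomes trivial and `Δ(A) / Δ(A)² ≅ A`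
applies. So `u - 1` dies under all these maps, and Dedekind's independence of characters gives
`u = 1` as soon as the `χ` separate torsion elements, that is, in the absence of elements of
infinite `p`-height.
-/

namespace DeltaAdic

open MonoidAlgebra

section Residue

variable {G : Type*} [Group G]

theorem of_sub_one_mem_augmentationIdeal (g : G) : of ℤ G g - 1 ∈ augmentationIdeal G := by
  rw [augmentationIdeal, RingHom.mem_ker, map_sub, map_one, of_apply, augmentation_single, sub_self]

theorem mem_deltaResidue_iff {u : (MonoidAlgebra ℤ G)ˣ} :
    u ∈ deltaResidue G ↔ ∀ n, (u : MonoidAlgebra ℤ G) - 1 ∈ augmentationIdeal G ^ n := by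
  simp only [deltaResidue, Subgroup.mem_iInf]
  refine ⟨fun h n => ?_, fun h n _ => ⟨?_, h n⟩⟩
  · obtain rfl | hn := n.eq_zero_or_pos
    · simp only [Submodule.pow_zero, Ideal.one_eq_top, Submodule.mem_top]
    · exact (h n hn).2
  · have h1 := h 1
    rwa [Submodule.pow_one, augmentationIdeal, RingHom.mem_ker, map_sub, map_one, sub_eq_zero] at h1

theorem eq_of_forall_sub_mem_pow (h : deltaResidue G = ⊥) {v w : (MonoidAlgebra ℤ G)ˣ}
    (hvw : ∀ n, (w : MonoidAlgebra ℤ G) - v ∈ augmentationIdeal G ^ n) : w = v := by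
  have hmem : v⁻¹ * w ∈ deltaResidue G := mem_deltaResidue_iff.2 fun n => by
    have hsub : ((v⁻¹ * w : (MonoidAlgebra ℤ G)ˣ) : MonoidAlgebra ℤ G) - 1
        = (v⁻¹ : (MonoidAlgebra ℤ G)ˣ) * ((w : MonoidAlgebra ℤ G) - v) := by
      rw [Units.val_mul, mul_sub, Units.inv_mul]
    exact hsub ▸ Ideal.mul_mem_left _ _ (hvw n)
  rw [h, Subgroup.mem_bot, inv_mul_eq_one] at hmem
  exact hmem.symm

end Residue

section CommRing

variable {B : Type*} [CommRing B]

theorem isUnit_one_sub_add_sq {c : B} {n : ℕ} (hc : c ^ n = 1) (hn : n.Coprime 6) :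
    IsUnit (1 - c + c ^ 2) := by
  rw [← Ideal.span_singleton_eq_top, Ideal.eq_top_iff_one, ← Ideal.Quotient.eq_zero_iff_mem,
    map_one]
  set f := Ideal.Quotient.mk (Ideal.span {1 - c + c ^ 2})
  have hroot : 1 - f c + f c ^ 2 = 0 := by
    rw [← map_pow, ← map_one f, ← map_sub, ← map_add]
    exact Ideal.Quotient.eq_zero_iff_mem.2 (Ideal.mem_span_singleton_self _)
  have hpow_six : f c ^ 6 = 1 := by
    linear_combination (f c ^ 4 + f c ^ 3 - f c - 1) * hroot
  have hpow_n : f c ^ n = 1 := by rw [← map_pow, hc, map_one]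
  have hone : f c = 1 := by
    rw [← pow_one (f c), ← hn.gcd_eq_one]
    exact pow_gcd_eq_one.2 ⟨hpow_n, hpow_six⟩
  rw [hone] at hroot
  linear_combination hroot

theorem sum_pow_sub_natCast_mem {I : Ideal B} {c : B} (hc : c - 1 ∈ I) (m : ℕ) :
    ∑ i ∈ Finset.range m, c ^ i - m ∈ I := by
  have hsum : ∑ i ∈ Finset.range m, c ^ i - m = ∑ i ∈ Finset.range m, (c ^ i - 1) := by simp
  exact hsum ▸ sum_mem fun i _ => I.mem_of_dvd (sub_one_dvd_pow_sub_one c i) hc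

theorem pow_pow_sub_one_mul_sub_one_mem {I : Ideal B} {x t : B} {m : ℕ} (hx : x - 1 ∈ I)
    (ht : t - 1 ∈ I) (htm : t ^ m = 1) (n : ℕ) : (x ^ m ^ n - 1) * (t - 1) ∈ I ^ n := by
  induction n with
  | zero => simp
  | succ n ih =>
    have hy : x ^ m ^ n - 1 ∈ I := I.mem_of_dvd (sub_one_dvd_pow_sub_one x _) hx
    have hty := geom_sum_mul (x ^ m ^ n) m
    have htt := geom_sum_mul t m
    rw [htm, sub_self] at htt
    -- Modulo `(∑ t ^ i) * (t - 1) = t ^ m - 1 = 0`, both geometric sums may be replaced by their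
    -- difference, which lies in `I` because each is congruent to `m`.
    have hfactor : (x ^ m ^ (n + 1) - 1) * (t - 1) = (x ^ m ^ n - 1) * (t - 1) *
        ((∑ i ∈ Finset.range m, (x ^ m ^ n) ^ i - m) - (∑ i ∈ Finset.range m, t ^ i - m)) := by
      rw [pow_succ m, pow_mul]
      linear_combination (x ^ m ^ n - 1) * htt - (t - 1) * hty
    rw [hfactor, pow_succ]
    exact Ideal.mul_mem_mul ih
      (sub_mem (sum_pow_sub_natCast_mem hy m) (sum_pow_sub_natCast_mem ht m))

end CommRing

section Height

variable {H : Type*} [CommGroup H] {p : ℕ}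

theorem hasInfinitePHeight_iff {g : H} :
    HasInfinitePHeight p g ↔ ∀ i, ∃ x : H, x ^ p ^ i = g := by
  refine ⟨fun h i => ?_, fun h i j _ => ?_⟩
  · obtain ⟨x, y, hy, hxy⟩ := h i 2 one_le_two
    rw [Subgroup.lowerCentralSeries_one_eq_bot_iff.2 inferInstance, Subgroup.mem_bot] at hy
    exact ⟨x, by rw [hxy, hy, mul_one]⟩
  · obtain ⟨x, hx⟩ := h i
    exact ⟨x, 1, one_mem _, by rw [hx, mul_one]⟩

theorem hasInfinitePHeight_of_coprime_orderOf {g : H} (hg : p.Coprime (orderOf g)) :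
    HasInfinitePHeight p g := hasInfinitePHeight_iff.2 fun i => by
  obtain ⟨m, hm⟩ := exists_pow_eq_self_of_coprime (hg.pow_left i)
  exact ⟨g ^ m, by rw [← pow_mul, mul_comm, pow_mul, hm]⟩

theorem isPGroup_of_forall_hasInfinitePHeight_eq_one (hp : p.Prime) (hH : IsMulTorsion H)
    (h : ∀ g : H, HasInfinitePHeight p g → g = 1) : IsPGroup p H := fun g => by
  obtain ⟨k, m, hm, hord⟩ := Nat.exists_eq_pow_mul_and_not_dvd (hH g).orderOf_pos.ne' p hp.ne_one
  have hk : orderOf (g ^ p ^ k) = m := by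
    rw [orderOf_pow_of_dvd (pow_ne_zero k hp.ne_zero) (hord ▸ dvd_mul_right _ _), hord,
      Nat.mul_div_cancel_left _ (pow_pos hp.pos k)]
  exact ⟨k, h _ (hasInfinitePHeight_of_coprime_orderOf
    (hk.symm ▸ (Nat.Prime.coprime_iff_not_dvd hp).2 hm))⟩

end Height

section Forward

theorem coprime_orderOf_six {M : Type*} [Monoid M] (hM : ∀ g : M, orderOf g ≠ 2 ∧ orderOf g ≠ 3)
    {a : M} (ha : IsOfFinOrder a) : (orderOf a).Coprime 6 := by
  have hexists : ∀ q, q ∣ orderOf a → ∃ b : M, orderOf b = q := fun q hq =>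
    ⟨_, orderOf_pow_orderOf_div ha.orderOf_pos.ne' hq⟩
  have htwo : ¬ 2 ∣ orderOf a := fun h => (hexists 2 h).elim fun b => (hM b).1
  have hthree : ¬ 3 ∣ orderOf a := fun h => (hexists 3 h).elim fun b => (hM b).2
  exact Nat.Coprime.mul_right ((Nat.Prime.coprime_iff_not_dvd Nat.prime_two).2 htwo).symm
    ((Nat.Prime.coprime_iff_not_dvd Nat.prime_three).2 hthree).symm

variable {G : Type*} [CommGroup G]

theorem sub_one_mul_sub_one_mul_add_ne_zero {a b : G} (ha : a ≠ 1) (hb : b ≠ 1) :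
    (of ℤ G a - 1) * (of ℤ G b - 1) * (of ℤ G a + of ℤ G b) ≠ 0 := by
  classical
  intro h
  have hexpand : of ℤ G a + of ℤ G b + of ℤ G (a * (a * b)) + of ℤ G (a * b * b)
      - of ℤ G (a * a) - of ℤ G (b * b) - of ℤ G (a * b) - of ℤ G (a * b) = 0 := by
    simp only [map_mul]
    linear_combination h
  have hcoeff := congrArg (fun x => x.coeff (a * b)) hexpand
  simp only [of_apply, coeff_sub, coeff_add, coeff_single, Finsupp.coe_sub, Finsupp.coe_add,
    Pi.sub_apply, Pi.add_apply, Finsupp.single_apply, coeff_zero, Finsupp.coe_zero,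
    Pi.zero_apply, left_eq_mul, right_eq_mul, mul_eq_right, mul_eq_left, ha, hb] at hcoeff
  grind

theorem isUnit_one_sub_of_add_of_sq {c : G} (hc : (orderOf c).Coprime 6) :
    IsUnit (1 - of ℤ G c + of ℤ G c ^ 2) :=
  isUnit_one_sub_add_sq (by rw [← map_pow, pow_orderOf_eq_one, map_one]) hc

theorem deltaResidue_ne_bot {a b : G} (ha : a ≠ 1) (hb : b ≠ 1)
    (ha6 : (orderOf a).Coprime 6) (hb6 : (orderOf b).Coprime 6)
    (hab : ∀ n, (of ℤ G a - 1) * (of ℤ G b - 1) ∈ augmentationIdeal G ^ n) :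
    deltaResidue G ≠ ⊥ := by
  intro hbot
  have hab6 : (orderOf (a * b)).Coprime 6 :=
    ((ha6.mul_left hb6).coprime_dvd_left (Nat.lcm_dvd_mul _ _)).coprime_dvd_left
      (Commute.all a b).orderOf_mul_dvd_lcm
  obtain ⟨u, hu⟩ := isUnit_one_sub_of_add_of_sq ha6
  obtain ⟨v, hv⟩ := isUnit_one_sub_of_add_of_sq hb6
  obtain ⟨w, hw⟩ := isUnit_one_sub_of_add_of_sq hab6
  have hdiff : (w : MonoidAlgebra ℤ G) - (u * v : (MonoidAlgebra ℤ G)ˣ)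
      = (of ℤ G a - 1) * (of ℤ G b - 1) * (of ℤ G a + of ℤ G b) := by
    rw [Units.val_mul, hu, hv, hw, map_mul]
    ring
  have hwuv : w = u * v := eq_of_forall_sub_mem_pow hbot fun n =>
    hdiff ▸ Ideal.mul_mem_right _ _ (hab n)
  rw [hwuv, sub_self] at hdiff
  exact sub_one_mul_sub_one_mul_add_ne_zero ha hb hdiff.symm

theorem exists_prime_orderOf (hG : ¬ IsMulTorsionFree G) :
    ∃ p, p.Prime ∧ ∃ a : G, orderOf a = p := by
  obtain ⟨a, ha, hfin⟩ := not_isMulTorsionFree_iff_isOfFinOrder.1 hG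
  exact ⟨_, Nat.minFac_prime (orderOf_eq_one_iff.not.2 ha), _,
    orderOf_pow_orderOf_div hfin.orderOf_pos.ne' (Nat.minFac_dvd _)⟩

theorem isMulTorsionFree_or_isPGroup (hG : ∀ g : G, orderOf g ≠ 2 ∧ orderOf g ≠ 3)
    (h : deltaResidue G = ⊥) :
    IsMulTorsionFree G ∨ ∃ p : ℕ, p.Prime ∧ IsPGroup p (CommGroup.torsion G) ∧
      ∀ t : CommGroup.torsion G, HasInfinitePHeight p t → t = 1 := by
  refine or_iff_not_imp_left.2 fun htf => ?_
  obtain ⟨p, hp, a, ha⟩ := exists_prime_orderOf htf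
  have ha_ne : a ≠ 1 := orderOf_eq_one_iff.not.1 (ha ▸ hp.ne_one)
  have ha_fin : IsOfFinOrder a := orderOf_pos_iff.1 (ha ▸ hp.pos)
  have hheight : ∀ t : CommGroup.torsion G, HasInfinitePHeight p t → t = 1 := by
    intro t ht
    by_contra ht_ne
    refine deltaResidue_ne_bot (Subtype.coe_ne_coe.2 ht_ne) ha_ne (coprime_orderOf_six hG t.2)
      (coprime_orderOf_six hG ha_fin) (fun n => ?_) h
    obtain ⟨x, rfl⟩ := hasInfinitePHeight_iff.1 ht n
    rw [SubmonoidClass.coe_pow, map_pow]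
    exact pow_pow_sub_one_mul_sub_one_mem (of_sub_one_mem_augmentationIdeal _)
      (of_sub_one_mem_augmentationIdeal _) (by rw [← map_pow, ← ha, pow_orderOf_eq_one, map_one]) n
  exact ⟨p, hp, isPGroup_of_forall_hasInfinitePHeight_eq_one hp
    (fun t => Submonoid.isOfFinOrder_coe.1 t.2) hheight, hheight⟩

end Forward

section TrivialUnits

theorem twoUniqueProds_of_isMulTorsionFree (A : Type*) [CommGroup A] [IsMulTorsionFree A] :
    TwoUniqueProds A := by
  have : TwoUniqueSums (Additive A) :=
    TwoUniqueSums.of_injective_addHom (DivisibleHull.coeAddMonoidHom (M := Additive A)).toAddHom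
      DivisibleHull.coe_injective inferInstance
  exact inferInstanceAs (TwoUniqueProds (Multiplicative (Additive A)))

variable {R A : Type*} [Semiring R] [NoZeroDivisors R] [Monoid A]

theorem mul_eq_one_of_uniqueMul {u w : MonoidAlgebra R A} (h : u * w = 1) {a b : A}
    (ha : a ∈ u.coeff.support) (hb : b ∈ w.coeff.support)
    (hab : UniqueMul u.coeff.support w.coeff.support a b) : a * b = 1 := by
  classical
  have hcoeff := coeff_mul_mul_of_uniqueMul hab
  rw [h, one_def, coeff_single, Finsupp.single_apply] at hcoeff
  by_contra hne
  rw [if_neg (Ne.symm hne)] at hcoeff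
  exact mul_ne_zero (Finsupp.mem_support_iff.1 ha) (Finsupp.mem_support_iff.1 hb) hcoeff.symm

theorem exists_eq_single_of_mul_eq_one [Nontrivial R] [TwoUniqueProds A] {u w : MonoidAlgebra R A}
    (h : u * w = 1) : ∃ a r, u = single a r := by
  suffices hcard : u.coeff.support.card ≤ 1 by
    obtain ⟨a, r, har⟩ := Finsupp.card_support_le_one'.1 hcard
    exact ⟨a, r, MonoidAlgebra.ext har⟩
  by_contra! hcard
  have hw : w.coeff.support.card ≠ 0 := fun hw => by
    rw [Finset.card_eq_zero, Finsupp.support_eq_empty, coeff_eq_zero] at hw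
    exact zero_ne_one (by rw [← h, hw, mul_zero])
  obtain ⟨p, hp, q, hq, hne, hup, huq⟩ := TwoUniqueProds.uniqueMul_of_one_lt_card
    (hcard.trans_le (Nat.le_mul_of_pos_right _ (Nat.pos_of_ne_zero hw)))
  rw [Finset.mem_product] at hp hq
  have hprod : q.1 * q.2 = p.1 * p.2 :=
    (mul_eq_one_of_uniqueMul h hq.1 hq.2 huq).trans (mul_eq_one_of_uniqueMul h hp.1 hp.2 hup).symm
  obtain ⟨h₁, h₂⟩ := hup hq.1 hq.2 hprod
  exact hne (Prod.ext h₁.symm h₂.symm)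

end TrivialUnits

section LiftRingHom

variable {G B C : Type*}

/-- The ring homomorphism `ℤG → B` extending a monoid homomorphism `G → B`. It is built
from `liftNCRingHom` rather than `MonoidAlgebra.lift`, so that no `ℤ`-algebra structure on `B` has
to be chosen. -/
noncomputable def liftRingHom [Monoid G] [Ring B] (F : G →* B) : MonoidAlgebra ℤ G →+* B :=
  liftNCRingHom (Int.castRingHom B) F fun n g => Int.cast_commute n (F g)

theorem liftRingHom_single [Monoid G] [Ring B] (F : G →* B) (g : G) (n : ℤ) :
    liftRingHom F (single g n) = n * F g := by
  simp [liftRingHom]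

theorem map_liftRingHom [Monoid G] [Ring B] [Ring C] (φ : B →+* C) (F : G →* B)
    (x : MonoidAlgebra ℤ G) : φ (liftRingHom F x) = liftRingHom ((φ : B →* C).comp F) x := by
  have h : φ.comp (liftRingHom F) = liftRingHom ((φ : B →* C).comp F) :=
    ringHom_ext (fun n => by simp [liftRingHom_single]) fun g => by simp [liftRingHom_single]
  exact DFunLike.congr_fun h x

theorem liftRingHom_one [Group G] [Ring B] (x : MonoidAlgebra ℤ G) :
    liftRingHom (1 : G →* B) x = augmentation G x := by
  have h : liftRingHom (1 : G →* B) = (Int.castRingHom B).comp (augmentation G).toRingHom :=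
    ringHom_ext (fun n => by simp [liftRingHom_single, augmentation_single])
      fun g => by simp [liftRingHom_single, augmentation_single]
  exact DFunLike.congr_fun h x

end LiftRingHom

section AdicLimit

variable {G B : Type*} [CommGroup G] [CommRing B] {I : Ideal B} {F : G →* B}

theorem liftRingHom_mem (hF : ∀ g, F g - 1 ∈ I) {x : MonoidAlgebra ℤ G}
    (hx : x ∈ augmentationIdeal G) : liftRingHom F x ∈ I := by
  have hFone : ((Ideal.Quotient.mk I : B →+* B ⧸ I) : B →* B ⧸ I).comp F = 1 :=
    MonoidHom.ext fun g => Ideal.Quotient.eq.2 (hF g)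
  have hx0 : augmentation G x = 0 := hx
  rw [← Ideal.Quotient.eq_zero_iff_mem, map_liftRingHom, hFone, liftRingHom_one, hx0, Int.cast_zero]

theorem liftRingHom_mem_pow (hF : ∀ g, F g - 1 ∈ I) {n : ℕ} {x : MonoidAlgebra ℤ G}
    (hx : x ∈ augmentationIdeal G ^ n) : liftRingHom F x ∈ I ^ n :=
  Ideal.le_comap_pow (liftRingHom F) n
    (Ideal.pow_right_mono (fun _ hy => liftRingHom_mem hF hy) n hx)

theorem liftRingHom_sub_one_mem_pow (hF : ∀ g, F g - 1 ∈ I) {u : (MonoidAlgebra ℤ G)ˣ}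
    (hu : u ∈ deltaResidue G) (n : ℕ) : liftRingHom F u - 1 ∈ I ^ n := by
  rw [← map_one (liftRingHom F), ← map_sub]
  exact liftRingHom_mem_pow hF (mem_deltaResidue_iff.1 hu n)

theorem liftRingHom_eq_one_of_isNoetherianRing [IsNoetherianRing B] [IsDomain B] (hI : I ≠ ⊤)
    (hF : ∀ g, F g - 1 ∈ I) {u : (MonoidAlgebra ℤ G)ˣ} (hu : u ∈ deltaResidue G) :
    liftRingHom F u = 1 := by
  rw [← sub_eq_zero, ← Ideal.mem_bot, ← Ideal.iInf_pow_eq_bot_of_isDomain I hI, Ideal.mem_iInf]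
  exact liftRingHom_sub_one_mem_pow hF hu

end AdicLimit

section Abelianization

variable {A : Type*} [CommGroup A]

theorem eq_one_of_of_sub_one_mem_sq {a : A} (h : of ℤ A a - 1 ∈ augmentationIdeal A ^ 2) :
    a = 1 := by
  -- `b ↦ 1 + b` is a homomorphism into the square-zero extension `ℤ ⊕ A`, and kills `Δ(A)²`.
  let _ : Module ℤᵐᵒᵖ (Additive A) :=
    Module.compHom _ ((RingHom.id ℤ).fromOpposite fun m n => mul_comm m n)
  have : IsCentralScalar ℤ (Additive A) := ⟨fun _ _ => rfl⟩
  let F : A →* TrivSqZeroExt ℤ (Additive A) :=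
    { toFun := fun b => 1 + TrivSqZeroExt.inr (Additive.ofMul b)
      map_one' := by simp
      map_mul' := fun b c => by
        rw [ofMul_mul, TrivSqZeroExt.inr_add]
        simp only [mul_add, add_mul, one_mul, mul_one, TrivSqZeroExt.inr_mul_inr, add_zero]
        abel }
  have hF : ∀ b, F b - 1 ∈ TrivSqZeroExt.kerIdeal ℤ (Additive A) := fun b => by
    simp [F, TrivSqZeroExt.mem_kerIdeal_iff_inr]
  have hFa := liftRingHom_mem_pow hF h
  rw [TrivSqZeroExt.kerIdeal_sq] at hFa
  rw [Ideal.mem_bot, map_sub, map_one, of_apply, liftRingHom_single, Int.cast_one, one_mul,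
    MonoidHom.coe_mk, OneHom.coe_mk, add_sub_cancel_left] at hFa
  exact ofMul_eq_zero.1 (TrivSqZeroExt.inr_injective hFa)

end Abelianization

section Twist

variable {G A R : Type*}

/-- The homomorphism `g ↦ χ(g) π(g)` from `G` to the group algebra `R[A]`: the projection `π`
twisted by the character `χ`. -/
noncomputable def twist [Monoid G] [Monoid A] [Semiring R] (χ : G →* R) (π : G →* A) :
    G →* MonoidAlgebra R A where
  toFun g := single (π g) (χ g)
  map_one' := by rw [map_one, map_one, one_def]
  map_mul' g h := by rw [map_mul, map_mul, single_mul_single]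

theorem mapRingHom_comp_twist [Monoid G] [Monoid A] [Semiring R] {S : Type*} [Semiring S]
    (φ : R →+* S) (χ : G →* R) (π : G →* A) :
    (mapRingHom A φ : MonoidAlgebra R A →* MonoidAlgebra S A).comp (twist χ π)
      = twist ((φ : R →* S).comp χ) π :=
  MonoidHom.ext fun g => by simp [twist]

theorem exists_liftRingHom_twist_eq_of [Monoid G] [CommGroup A] [IsMulTorsionFree A] [CommRing R]
    [IsDomain R] {χ : G →* R} (π : G →* A) {u : (MonoidAlgebra ℤ G)ˣ} (hu : liftRingHom χ u = 1) :
    ∃ a, liftRingHom (twist χ π) u = of R A a := by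
  have := twoUniqueProds_of_isMulTorsionFree A
  have hmul : liftRingHom (twist χ π) u * liftRingHom (twist χ π) ↑u⁻¹ = 1 := by
    rw [← map_mul, u.mul_inv, map_one]
  obtain ⟨a, r, har⟩ := exists_eq_single_of_mul_eq_one hmul
  have hcomp : ((MonoidAlgebra.lift R R A 1 : MonoidAlgebra R A →+* R) :
      MonoidAlgebra R A →* R).comp (twist χ π) = χ :=
    MonoidHom.ext fun g => by simp [twist]
  have hr : r = 1 := by
    rw [← hcomp, ← map_liftRingHom, har] at hu
    simpa using hu
  exact ⟨a, by rw [har, hr, of_apply]⟩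

variable [CommGroup G] [CommGroup A]

theorem liftRingHom_twist_one_eq_one [IsMulTorsionFree A] (π : G →* A) {u : (MonoidAlgebra ℤ G)ˣ}
    (hu : u ∈ deltaResidue G) : liftRingHom (twist (1 : G →* ℤ) π) u = 1 := by
  have hχ : liftRingHom (1 : G →* ℤ) u = 1 :=
    liftRingHom_eq_one_of_isNoetherianRing (I := ⊥) bot_ne_top (fun g => by simp) hu
  obtain ⟨a, ha⟩ := exists_liftRingHom_twist_eq_of π hχ
  have hsq := liftRingHom_sub_one_mem_pow (F := twist 1 π) (I := augmentationIdeal A)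
    (fun g => of_sub_one_mem_augmentationIdeal (π g)) hu 2
  rw [ha] at hsq ⊢
  rw [eq_one_of_of_sub_one_mem_sq hsq, map_one]

theorem liftRingHom_twist_eq_one [CommRing R] [IsDomain R] [IsNoetherianRing R]
    [IsMulTorsionFree A] {I : Ideal R} (hI : I ≠ ⊤) {χ : G →* R} (hχ : ∀ g, χ g - 1 ∈ I)
    (π : G →* A) {u : (MonoidAlgebra ℤ G)ˣ} (hu : u ∈ deltaResidue G) :
    liftRingHom (twist χ π) u = 1 := by
  have : Nontrivial (R ⧸ I) := Ideal.Quotient.nontrivial_iff.2 hI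
  obtain ⟨a, ha⟩ := exists_liftRingHom_twist_eq_of π
    (liftRingHom_eq_one_of_isNoetherianRing hI hχ hu)
  have hquot : ((Ideal.Quotient.mk I : R →+* R ⧸ I) : R →* R ⧸ I).comp χ
      = ((Int.castRingHom (R ⧸ I) : ℤ →+* R ⧸ I) : ℤ →* R ⧸ I).comp 1 :=
    MonoidHom.ext fun g => by simpa using Ideal.Quotient.eq.2 (hχ g)
  have hred : mapRingHom A (Ideal.Quotient.mk I) (of R A a) = 1 := by
    rw [← ha, map_liftRingHom, mapRingHom_comp_twist, hquot, ← mapRingHom_comp_twist,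
      ← map_liftRingHom, liftRingHom_twist_one_eq_one π hu, map_one]
  have hone : of (R ⧸ I) A a = of (R ⧸ I) A 1 := by
    rw [map_one, ← hred]
    simp
  rw [ha, of_injective hone, map_one]

end Twist

section RootsOfUnity

theorem exists_isPrime_natCast_mem {R : Type*} [CommRing R] [CharZero R] [Algebra.IsIntegral ℤ R]
    {p : ℕ} (hp : p.Prime) : ∃ I : Ideal R, I.IsPrime ∧ (p : R) ∈ I := by
  have : (Ideal.span {(p : ℤ)}).IsPrime :=
    (Ideal.span_singleton_prime (Int.natCast_ne_zero.2 hp.ne_zero)).2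
      (Nat.prime_iff_prime_int.1 hp)
  obtain ⟨I, hI, hover⟩ := Ideal.nonempty_primesOver (S := R) (Ideal.span {(p : ℤ)})
  refine ⟨I, hI, ?_⟩
  simpa using (Ideal.mem_of_liesOver I _ (p : ℤ)).1 (Ideal.mem_span_singleton_self _)

theorem sub_one_mem_of_pow_prime_pow_eq_one {R : Type*} [CommRing R] {I : Ideal R} [I.IsPrime]
    {p k : ℕ} (hp : p.Prime) (hpI : (p : R) ∈ I) {x : R} (hx : x ^ p ^ k = 1) : x - 1 ∈ I := by
  obtain ⟨r, hr⟩ := exists_add_pow_prime_pow_eq hp (x - 1) 1 k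
  rw [sub_add_cancel, hx, one_pow] at hr
  have hpow : (x - 1) ^ p ^ k = -((x - 1) * r) * p := by linear_combination -hr
  exact Ideal.IsPrime.mem_of_pow_mem ‹_› _ (hpow ▸ I.mul_mem_left _ hpI)

variable {G K : Type*} [Monoid G] [CommRing K]

theorem isIntegral_adjoin_range {χ : G →* K} {n : ℕ} (hn : 0 < n) (hχ : χ ^ n = 1) :
    Algebra.IsIntegral ℤ (Algebra.adjoin ℤ (Set.range χ)) := by
  refine Algebra.IsIntegral.adjoin ?_
  rintro _ ⟨g, rfl⟩
  have hg : χ g ^ n = 1 := DFunLike.congr_fun hχ g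
  exact IsIntegral.of_pow hn (hg ▸ isIntegral_one)

variable [IsDomain K]

theorem isNoetherianRing_adjoin_range {χ : G →* K} {n : ℕ} (hn : 0 < n) (hχ : χ ^ n = 1) :
    IsNoetherianRing (Algebra.adjoin ℤ (Set.range χ)) := by
  have hsub : Set.range χ ⊆ Polynomial.nthRootsFinset n (1 : K) := by
    rintro _ ⟨g, rfl⟩
    exact (Polynomial.mem_nthRootsFinset hn 1).2 (DFunLike.congr_fun hχ g)
  exact isNoetherianRing_of_fg (Subalgebra.fg_def.2 ⟨_, (Finset.finite_toSet _).subset hsub, rfl⟩)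

end RootsOfUnity

theorem liftRingHom_twist_eq_one_of_pow_prime_pow_eq_one {G A K : Type*} [CommGroup G]
    [CommGroup A] [IsMulTorsionFree A] [CommRing K] [IsDomain K] [CharZero K] {p k : ℕ}
    (hp : p.Prime) {χ : G →* K} (hχ : χ ^ p ^ k = 1) (π : G →* A) {u : (MonoidAlgebra ℤ G)ˣ}
    (hu : u ∈ deltaResidue G) : liftRingHom (twist χ π) u = 1 := by
  have hpk : 0 < p ^ k := pow_pos hp.pos k
  let R := Algebra.adjoin ℤ (Set.range χ)
  have : IsNoetherianRing R := isNoetherianRing_adjoin_range hpk hχ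
  have : Algebra.IsIntegral ℤ R := isIntegral_adjoin_range hpk hχ
  obtain ⟨I, hI, hpI⟩ := exists_isPrime_natCast_mem (R := R) hp
  let ψ : G →* R := χ.codRestrict R fun g => Algebra.subset_adjoin ⟨g, rfl⟩
  have hψ : ∀ g, ψ g - 1 ∈ I := fun g =>
    sub_one_mem_of_pow_prime_pow_eq_one hp hpI (Subtype.ext (DFunLike.congr_fun hχ g))
  have hψχ : ((R.val : R →+* K) : R →* K).comp ψ = χ := rfl
  rw [← hψχ, ← mapRingHom_comp_twist, ← map_liftRingHom, liftRingHom_twist_eq_one hI.ne_top hψ π hu,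
    map_one]

section Separation

theorem exists_injective_monoidHom_addCircle_rat :
    ∃ f : Multiplicative (AddCircle (1 : ℚ)) →* ℂ, Function.Injective f := by
  let f : AddCircle (1 : ℚ) →+ AddCircle (1 : ℝ) :=
    QuotientAddGroup.map _ _ (Rat.castHom ℝ : ℚ →+ ℝ) (by
      rintro _ ⟨n, rfl⟩
      exact ⟨n, by simp⟩)
  have hf : Function.Injective f := (injective_iff_map_eq_zero f).2 fun x => by
    induction x using QuotientAddGroup.induction_on with
    | H q =>
      intro hq
      obtain ⟨n, hn⟩ := (QuotientAddGroup.eq_zero_iff _).1 hq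
      refine (QuotientAddGroup.eq_zero_iff _).2 ⟨n, ?_⟩
      exact Rat.cast_injective (α := ℝ) (by simpa using hn)
  refine ⟨{ toFun := fun x => (f x.toAdd).toCircle
            map_one' := by simp
            map_mul' := by simp [AddCircle.toCircle_add] }, fun x y hxy => ?_⟩
  exact hf (AddCircle.injective_toCircle one_ne_zero (Circle.ext hxy))

theorem exists_monoidHom_complex_ne_one {H : Type*} [CommGroup H] {h : H} (hh : h ≠ 1) :
    ∃ χ : H →* ℂ, χ h ≠ 1 := by
  obtain ⟨c, hc⟩ := CharacterModule.exists_character_apply_ne_zero_of_ne_zero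
    (A := Additive H) (a := Additive.ofMul h) (by simpa using hh)
  obtain ⟨f, hf⟩ := exists_injective_monoidHom_addCircle_rat
  let c' : Additive H →+ AddCircle (1 : ℚ) := c
  refine ⟨f.comp (AddMonoidHom.toMultiplicativeRight c'), fun h1 => hc ?_⟩
  exact hf (h1.trans (map_one f).symm)

theorem exists_pow_eq_one_and_apply_ne_one {G : Type*} [CommGroup G] {n : ℕ} {t : G}
    (ht : ∀ x : G, x ^ n ≠ t) : ∃ χ : G →* ℂ, χ ^ n = 1 ∧ χ t ≠ 1 := by
  let N := (powMonoidHom n : G →* G).range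
  have htN : QuotientGroup.mk' N t ≠ 1 := fun h =>
    ((QuotientGroup.eq_one_iff t).1 h).elim ht
  obtain ⟨χ, hχ⟩ := exists_monoidHom_complex_ne_one htN
  refine ⟨χ.comp (QuotientGroup.mk' N), MonoidHom.ext fun g => ?_, hχ⟩
  have hgN : QuotientGroup.mk' N (g ^ n) = 1 := (QuotientGroup.eq_one_iff _).2 ⟨g, rfl⟩
  rw [MonoidHom.pow_apply, MonoidHom.comp_apply, ← map_pow, ← map_pow, hgN, map_one,
    MonoidHom.one_apply]

theorem linearIndepOn_eval {G K : Type*} [Monoid G] [CommRing K] [IsDomain K]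
    {X : Submonoid (G →* K)} {s : Set G} (hX : ∀ g ∈ s, ∀ h ∈ s, (∀ χ ∈ X, χ g = χ h) → g = h) :
    LinearIndepOn K (fun (g : G) (χ : X) => (χ : G →* K) g) s := by
  refine (linearIndependent_monoidHom X K).comp
    (fun g : s => (MonoidHom.eval (g : G)).comp X.subtype) fun g h hgh => Subtype.ext ?_
  exact hX g g.2 h h.2 fun χ hχ => DFunLike.congr_fun hgh (⟨χ, hχ⟩ : X)

variable {G A K : Type*} [Group G] [Monoid A] [CommRing K]

theorem coeff_liftRingHom_twist [DecidableEq A] (χ : G →* K) (π : G →* A) (x : MonoidAlgebra ℤ G)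
    (a : A) : (liftRingHom (twist χ π) x).coeff a
      = ∑ g ∈ x.coeff.support with π g = a, (x.coeff g : K) * χ g := by
  have hsingle : ∀ g, (liftRingHom (twist χ π) (single g (x.coeff g))).coeff a
      = if π g = a then (x.coeff g : K) * χ g else 0 := fun g => by
    rw [liftRingHom_single, ← zsmul_eq_mul, coeff_smul, Finsupp.smul_apply, zsmul_eq_mul, twist,
      MonoidHom.coe_mk, OneHom.coe_mk, coeff_single, Finsupp.single_apply, mul_ite, mul_zero]
  conv_lhs => rw [← sum_coeff_single x]
  rw [Finsupp.sum, map_sum, coeff_sum, Finsupp.finsetSum_apply, Finset.sum_filter]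
  exact Finset.sum_congr rfl fun g _ => hsingle g

theorem eq_zero_of_forall_liftRingHom_twist_eq_zero [IsDomain K] [CharZero K]
    {X : Submonoid (G →* K)} {π : G →* A} (hX : ∀ g h, π g = π h → (∀ χ ∈ X, χ g = χ h) → g = h)
    {x : MonoidAlgebra ℤ G} (hx : ∀ χ ∈ X, liftRingHom (twist χ π) x = 0) : x = 0 := by
  classical
  refine MonoidAlgebra.ext (Finsupp.ext fun g₀ => by_contra fun hg₀ => hg₀ ?_)
  let s := {g ∈ x.coeff.support | π g = π g₀}
  have hs : ∀ g ∈ s, π g = π g₀ := fun g hg => (Finset.mem_filter.1 hg).2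
  have hindep : LinearIndepOn K (fun (g : G) (χ : X) => (χ : G →* K) g) s :=
    linearIndepOn_eval fun g hg h hh => hX g h ((hs g hg).trans (hs h hh).symm)
  have hsum : ∑ g ∈ s, (x.coeff g : K) • (fun χ : X => (χ : G →* K) g) = 0 := by
    ext χ
    have hcoeff := congrArg (fun y => y.coeff (π g₀)) (hx χ χ.2)
    rw [coeff_liftRingHom_twist] at hcoeff
    simpa only [Finset.sum_apply, Pi.smul_apply, smul_eq_mul, coeff_zero, Finsupp.coe_zero,
      Pi.zero_apply] using hcoeff
  exact Int.cast_eq_zero.1 (linearIndepOn_finset_iff.1 hindep _ hsum g₀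
    (Finset.mem_filter.2 ⟨Finsupp.mem_support_iff.2 hg₀, rfl⟩))

end Separation

section Backward

variable {G : Type*} [CommGroup G] {p : ℕ}

/-- The complex characters of `G` whose order is a power of `p`; these are the twists that
become trivial modulo a prime above `p`. -/
def primePowerCharacters (G : Type*) [CommGroup G] (p : ℕ) : Submonoid (G →* ℂ) where
  carrier := {χ | ∃ k : ℕ, χ ^ p ^ k = 1}
  one_mem' := ⟨0, one_pow _⟩
  mul_mem' := by
    rintro χ ψ ⟨k, hk⟩ ⟨l, hl⟩
    exact ⟨k + l, by rw [mul_pow, pow_add, pow_mul, hk, one_pow, pow_mul', hl, one_pow, one_mul]⟩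

theorem exists_primePowerCharacter_apply_ne_one (hp : p ≠ 0)
    (hT : ∀ t : CommGroup.torsion G, HasInfinitePHeight p t → t = 1) {t : G}
    (ht : IsOfFinOrder t) (ht_ne : t ≠ 1) : ∃ χ ∈ primePowerCharacters G p, χ t ≠ 1 := by
  have hheight : ¬ HasInfinitePHeight p (⟨t, ht⟩ : CommGroup.torsion G) := fun h =>
    ht_ne (congrArg Subtype.val (hT _ h))
  simp only [hasInfinitePHeight_iff, not_forall, not_exists] at hheight
  obtain ⟨i, hi⟩ := hheight
  have hroot : ∀ x : G, x ^ p ^ i ≠ t := fun x hx =>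
    hi ⟨x, IsOfFinOrder.of_pow (hx ▸ ht) (pow_ne_zero i hp)⟩ (Subtype.ext hx)
  obtain ⟨χ, hχ, hχt⟩ := exists_pow_eq_one_and_apply_ne_one hroot
  exact ⟨χ, ⟨i, hχ⟩, hχt⟩

theorem eq_of_forall_primePowerCharacter_apply_eq (hp : p ≠ 0)
    (hT : ∀ t : CommGroup.torsion G, HasInfinitePHeight p t → t = 1) {g h : G}
    (hgh : IsOfFinOrder (g / h)) (hχ : ∀ χ ∈ primePowerCharacters G p, χ g = χ h) : g = h := by
  by_contra hne
  obtain ⟨χ, hχ_mem, hχ_ne⟩ :=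
    exists_primePowerCharacter_apply_ne_one hp hT hgh (div_eq_one.not.2 hne)
  refine hχ_ne ?_
  rw [div_eq_mul_inv, map_mul, hχ χ hχ_mem, ← map_mul, mul_inv_cancel, map_one]

theorem deltaResidue_eq_bot (hp : p.Prime)
    (hT : ∀ t : CommGroup.torsion G, HasInfinitePHeight p t → t = 1) : deltaResidue G = ⊥ := by
  refine (Subgroup.eq_bot_iff_forall _).2 fun u hu => Units.ext (sub_eq_zero.1 ?_)
  refine eq_zero_of_forall_liftRingHom_twist_eq_zero (X := primePowerCharacters G p)
    (π := QuotientGroup.mk' (CommGroup.torsion G)) (fun g h hgh hχ => ?_) ?_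
  · refine eq_of_forall_primePowerCharacter_apply_eq hp.ne_zero hT ?_ hχ
    exact (QuotientGroup.eq_one_iff (g / h)).1 (div_eq_one.2 hgh)
  · rintro χ ⟨k, hk⟩
    rw [map_sub, liftRingHom_twist_eq_one_of_pow_prime_pow_eq_one hp hk _ hu, Units.val_one,
      map_one, sub_self]

end Backward

end DeltaAdic

theorem mainTheorem6 (G : Type*) [CommGroup G]
    (hG : ∀ g : G, orderOf g ≠ 2 ∧ orderOf g ≠ 3) :
    DeltaAdic.deltaResidue G = ⊥ ↔
      (IsMulTorsionFree G ∨
        ∃ p : ℕ, p.Prime ∧ IsPGroup p (CommGroup.torsion G) ∧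
          ∀ t : CommGroup.torsion G, DeltaAdic.HasInfinitePHeight p t → t = 1) := by
  refine ⟨DeltaAdic.isMulTorsionFree_or_isPGroup hG, ?_⟩
  rintro (htf | ⟨p, hp, -, hT⟩)
  · exact DeltaAdic.deltaResidue_eq_bot Nat.prime_two fun t _ =>
      Subtype.ext (IsOfFinOrder.eq_one' t.2)
  · exact DeltaAdic.deltaResidue_eq_bot hp hT
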